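/- All graphs are finite and simple. For a perfect matching $M$ of a graph $G$, let $af(G,M)$ be the minimum size of a set $S\subseteq E(G)\setminus M$ such that $M$ is the only perfect matching of $G-S$. Write $Af(G)=k$ if $G$ has a perfect matching and $k$ is the maximum of $af(G,M)$ over all perfect matchings $M$ of $G$. A polyomino graph is a finite connected subgraph $G$ of the infinite square grid in the plane such that each edge of $G$ lies on a square of $G$ and every interior (bounded) face of $G$ is the interior of a unit cell of the grid; here a square of $G$ is the boundary $4$-cycle of a unit cell of the grid all four of whose sides are edges of $G$. A polyomino graph is a straight chain if it is $2$-connected (it has at least three vertices, is connected, and stays connected after the deletion of any one vertex) and each of its vertices is contained in at most two of its squares. Corollary 3.8. Let $G$ be a polyomino graph with $n$ squares. Then $Af(G)=n$ if and only if $G$ is a straight chain. -/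

import Mathlib

/-! ### Anti-forcing numbers of perfect matchings -/

namespace AntiForcing

variable {V : Type*} {H : SimpleGraph V}

/-- `S` is an anti-forcing set of the perfect matching `M` of `H`: it is a set of edges of `H` not
in `M` such that `M` is the only perfect matching of `H - S`. (That `M` is a perfect matching of
`H - S` is automatic, because `S` avoids `M`.) -/
def IsAntiForcingSet (M : H.Subgraph) (S : Set (Sym2 V)) : Prop :=
  S ⊆ H.edgeSet \ M.edgeSet ∧
    ∀ M' : (H.deleteEdges S).Subgraph, M'.IsPerfectMatching → M'.edgeSet = M.edgeSet

/-- The anti-forcing number `af(H, M)`: the least size of an anti-forcing set of `M`. For a perfect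
matching `M` of a finite graph the minimum is over a nonempty set of numbers, since the set of all
edges outside `M` is anti-forcing. -/
noncomputable def antiForcingNumber (M : H.Subgraph) : ℕ :=
  sInf {k | ∃ S : Finset (Sym2 V), IsAntiForcingSet M (S : Set (Sym2 V)) ∧ S.card = k}

/-- The anti-forcing spectrum: the set of anti-forcing numbers of all perfect matchings of `H`. -/
def antiForcingSpectrum (H : SimpleGraph V) : Set ℕ :=
  {k | ∃ M : H.Subgraph, M.IsPerfectMatching ∧ antiForcingNumber M = k}

/-- `Af(H) = k`: the number `k` is the largest anti-forcing number over all perfect matchings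
of `H` (so, in particular, `H` has a perfect matching). -/
def IsMaxAntiForcingNumber (H : SimpleGraph V) (k : ℕ) : Prop :=
  IsGreatest (antiForcingSpectrum H) k

/-- `H` is 2-connected: it has at least three vertices, it is connected, and it remains connected
after the deletion of any one vertex. -/
def IsTwoConnected (H : SimpleGraph V) : Prop :=
  3 ≤ ENat.card V ∧ H.Connected ∧ ∀ v : V, (H.induce {v}ᶜ).Connected

end AntiForcing

/-! ### Polyomino graphs -/

namespace Polyomino

/-- The infinite square grid: two points of `ℤ × ℤ` are adjacent if they are at distance one. -/
def grid : SimpleGraph (ℤ × ℤ) where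
  Adj p q := (p.1 = q.1 ∧ (q.2 = p.2 + 1 ∨ p.2 = q.2 + 1)) ∨
    (p.2 = q.2 ∧ (q.1 = p.1 + 1 ∨ p.1 = q.1 + 1))
  symm := ⟨fun p q h => by omega⟩
  loopless := ⟨fun p h => by omega⟩

/-- The four corners of the unit cell of the grid whose lower left corner is `c`. A cell is always
named by its lower left corner. -/
def corners (c : ℤ × ℤ) : Set (ℤ × ℤ) :=
  {p | (p.1 = c.1 ∨ p.1 = c.1 + 1) ∧ (p.2 = c.2 ∨ p.2 = c.2 + 1)}

/-- The squares of a subgraph `G` of the grid: the unit cells all four sides of which are edges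
of `G`. (The sides of a cell are the grid edges joining two of its corners.) -/
def squares (G : grid.Subgraph) : Set (ℤ × ℤ) :=
  {c | ∀ p ∈ corners c, ∀ q ∈ corners c, grid.Adj p q → G.Adj p q}

/-- Two distinct unit cells are adjacent in `cellGraph G` if they have a common side that is not an
edge of `G`. So two cells are in the same connected component exactly if one can walk in the plane
from the interior of one to the interior of the other without crossing the drawing of `G`: the
components are the faces of the plane graph `G` (each recorded as the set of its unit cells). -/
def cellGraph (G : grid.Subgraph) : SimpleGraph (ℤ × ℤ) where
  Adj c d := c ≠ d ∧ ∃ p ∈ corners c ∩ corners d, ∃ q ∈ corners c ∩ corners d,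
    grid.Adj p q ∧ ¬ G.Adj p q
  symm := ⟨fun _ _ ⟨hne, p, hp, q, hq, h⟩ => ⟨hne.symm, p, hp.symm, q, hq.symm, h⟩⟩
  loopless := ⟨fun _ h => h.1 rfl⟩

/-- A polyomino graph: a finite connected subgraph of the square grid such that every edge lies on
one of its squares and every interior (that is, bounded) face is a single unit cell, surrounded
by a square. -/
structure IsPolyomino (G : grid.Subgraph) : Prop where
  finite : G.verts.Finite
  connected : G.Connected
  edge_mem_square : ∀ p q, G.Adj p q → ∃ c ∈ squares G, p ∈ corners c ∧ q ∈ corners c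
  interior_face : ∀ F : (cellGraph G).ConnectedComponent, F.supp.Finite →
    ∃ c ∈ squares G, F.supp = {c}

/-- A straight chain: a polyomino graph that is 2-connected and each vertex of which is contained
in at most two squares. -/
def IsStraightChain (G : grid.Subgraph) : Prop :=
  IsPolyomino G ∧ AntiForcing.IsTwoConnected G.coe ∧
    ∀ v ∈ G.verts, {c ∈ squares G | v ∈ corners c}.encard ≤ 2

end Polyomino

/-! ### Mod 2 cycles of the grid and the cells they bound -/

namespace Polyomino

/-! Fix a perfect matching M and one of the four diagonal directions. For each square whose corner
in that direction is matched inside the square, select the other side at that corner. The selected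
edges anti-force M: the symmetric difference with another perfect matching is a mod 2 cycle, so it
bounds a finite set of squares, because bounded faces are cells. A square of this set that is
extreme in the chosen direction has both sides at its corner in the difference, one in M and the
other selected (`exists_corner`, `exists_isAntiForcingSet`). Hence af ≤ n, and equality, used in all
four directions, makes every square alternating. Conversely, if all squares alternate, an
anti-forcing set contains a non-M side of each square, and no such edge lies in two squares, so af =
n (`antiForcingNumber_eq`).

It remains to see that a perfect matching with all squares alternating exists exactly for straight
chains. Given one, the squares at a vertex all contain the matching edge there, which gives both the
bound two and 2-connectedness. In a straight chain, squares that meet share a side and the chain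
never turns, so the edges across it form the matching. -/

theorem mem_corners {c p : ℤ × ℤ} :
    p ∈ corners c ↔ (p.1 = c.1 ∨ p.1 = c.1 + 1) ∧ (p.2 = c.2 ∨ p.2 = c.2 + 1) := Iff.rfl

theorem grid_adj {p q : ℤ × ℤ} :
    grid.Adj p q ↔ (p.1 = q.1 ∧ (q.2 = p.2 + 1 ∨ p.2 = q.2 + 1)) ∨
      (p.2 = q.2 ∧ (q.1 = p.1 + 1 ∨ p.1 = q.1 + 1)) := Iff.rfl

/-- `p` is a primitive of the mod 2 edge function `z`: the value of `z` on an edge is the sum of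
the values of `p` on the two cells that the edge separates. -/
structure IsPrimitive (p : ℤ × ℤ → ZMod 2) (z : ℤ × ℤ → ℤ × ℤ → ZMod 2) : Prop where
  vertical : ∀ x y, p (x, y) + p (x - 1, y) = z (x, y) (x, y + 1)
  horizontal : ∀ x y, p (x, y) + p (x, y - 1) = z (x, y) (x + 1, y)

/-- A mod 2 edge function is a cycle if the values on the four grid edges at each vertex sum to
zero. -/
def IsCycle (z : ℤ × ℤ → ℤ × ℤ → ZMod 2) : Prop :=
  ∀ x y, z (x, y) (x + 1, y) + z (x, y) (x - 1, y) + z (x, y) (x, y + 1) + z (x, y) (x, y - 1) = 0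

/-- The value at a cell sums `z` over the vertical edges on the ray to its left. The vertical
relation telescopes; the horizontal one propagates rightwards by the cycle condition. To the right
of the support the values are constant along columns and vanish far below, hence are zero. -/
theorem IsCycle.exists_isPrimitive {z : ℤ × ℤ → ℤ × ℤ → ZMod 2} (hz : IsCycle z)
    (hsymm : ∀ p q, z p q = z q p) {s : Set (ℤ × ℤ)} (hs : s.Finite)
    (hsupp : ∀ p q, z p q ≠ 0 → p ∈ s) :
    ∃ p : ℤ × ℤ → ZMod 2, IsPrimitive p z ∧ {c | p c ≠ 0}.Finite := by
  obtain ⟨N, hN⟩ : ∃ N : ℤ, ∀ p ∈ s, -N < p.1 ∧ p.1 < N ∧ -N < p.2 ∧ p.2 < N := by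
    obtain ⟨A, hA⟩ := (hs.image fun p => |p.1| + |p.2|).bddAbove
    refine ⟨A + 1, fun p hp => ?_⟩
    have h := hA ⟨p, hp, rfl⟩
    have h1 := abs_nonneg p.1
    have h2 := abs_nonneg p.2
    have h3 := neg_abs_le p.1
    have h4 := neg_abs_le p.2
    have h5 := le_abs_self p.1
    have h6 := le_abs_self p.2
    simp only at h
    omega
  have zero : ∀ p q, (p.1 ≤ -N ∨ N ≤ p.1 ∨ p.2 ≤ -N ∨ N ≤ p.2) → z p q = 0 := by
    intro p q h
    by_contra hne
    have := hN p (hsupp p q hne)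
    omega
  have two : (2 : ZMod 2) = 0 := by decide
  let P : ℤ × ℤ → ZMod 2 := fun c => ∑ i ∈ Finset.Icc (-N) c.1, z (i, c.2) (i, c.2 + 1)
  have left : ∀ x y, x < -N → P (x, y) = 0 := by
    intro x y hx
    simp only [P]
    rw [Finset.Icc_eq_empty (by simpa using hx), Finset.sum_empty]
  have vert : ∀ x y, P (x, y) = P (x - 1, y) + z (x, y) (x, y + 1) := by
    intro x y
    rcases lt_or_ge x (-N) with hx | hx
    · rw [left x y hx, left (x - 1) y (by omega), zero (x, y) _ (Or.inl hx.le), add_zero]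
    · have : Finset.Icc (-N) x = insert x (Finset.Icc (-N) (x - 1)) := by
        ext i
        simp only [Finset.mem_Icc, Finset.mem_insert]
        omega
      simp only [P]
      rw [this, Finset.sum_insert (by simp), add_comm]
  have horiz : ∀ x y, P (x, y) + P (x, y - 1) = z (x, y) (x + 1, y) := by
    intro x y
    rcases lt_or_ge x (-N) with hx | hx
    · rw [left x y hx, left x _ hx, zero (x, y) _ (Or.inl hx.le), add_zero]
    · have hx' : -N - 1 ≤ x := by omega
      clear hx
      induction x, hx' using Int.leInduction with
      | base =>
        rw [left _ y (by omega), left _ _ (by omega), zero (_, y) _ (Or.inl (by simp)), add_zero]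
      | succ x _ ih =>
        have h1 := vert (x + 1) y
        have h2 := vert (x + 1) (y - 1)
        have h3 := hz (x + 1) y
        have h4 := hsymm (x + 1, y) (x, y)
        have h5 := hsymm (x + 1, y - 1) (x + 1, y)
        simp only [add_sub_cancel_right, sub_add_cancel] at h1 h2 h3
        linear_combination h1 + h2 + ih + h3 - h4 + h5 - z (x + 1, y) (x + 1 + 1, y) * two
  have out : ∀ x y, (y ≤ -N ∨ N ≤ y) → P (x, y) = 0 := fun x y hy =>
    Finset.sum_eq_zero fun i _ => zero _ _ (Or.inr (Or.inr hy))
  have right : ∀ x y, N ≤ x → P (x, y) = 0 := by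
    intro x y hx
    rcases le_or_gt y (-N) with hy | hy
    · exact out x y (Or.inl hy)
    · have hy' := hy.le
      clear hy
      induction y, hy' using Int.leInduction with
      | base => exact out x _ (Or.inl le_rfl)
      | succ y _ ih =>
        have h := horiz x (y + 1)
        rw [zero _ _ (Or.inr (Or.inl hx)), add_sub_cancel_right, ih, add_zero] at h
        exact h
  refine ⟨P, ⟨fun x y => ?_, horiz⟩, ?_⟩
  · linear_combination vert x y + P (x - 1, y) * two
  · refine ((Set.finite_Icc (-N) N).prod (Set.finite_Icc (-N) N)).subset ?_
    rintro ⟨x, y⟩ h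
    by_contra hxy
    simp only [Set.mem_prod, Set.mem_Icc] at hxy
    refine h ?_
    rcases lt_or_ge x (-N) with h1 | h1
    · exact left x y h1
    rcases le_or_gt N x with h2 | h2
    · exact right x y h2
    · exact out x y (by omega)

/-- The cells are separated by a non-edge of `G`, where `z` vanishes. So a primitive is constant on
each face. -/
theorem IsPrimitive.eq_of_cellGraph_adj {G : grid.Subgraph} {z : ℤ × ℤ → ℤ × ℤ → ZMod 2}
    {P : ℤ × ℤ → ZMod 2} (hP : IsPrimitive P z) (hsymm : ∀ p q, z p q = z q p)
    (hsupp : ∀ p q, z p q ≠ 0 → G.Adj p q) {c d : ℤ × ℤ} (h : (cellGraph G).Adj c d) :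
    P c = P d := by
  obtain ⟨hne, p, hp, q, hq, hadj, hG⟩ := h
  have hz : z p q = 0 := by
    by_contra h
    exact hG (hsupp p q h)
  clear hG hsupp
  have key : ∀ p q : ℤ × ℤ, p ∈ corners c ∩ corners d → q ∈ corners c ∩ corners d → z p q = 0 →
      (p.1 = q.1 ∧ q.2 = p.2 + 1 ∨ p.2 = q.2 ∧ q.1 = p.1 + 1) → P c = P d := by
    rintro ⟨x, y⟩ ⟨x', y'⟩ ⟨hp, hp'⟩ ⟨hq, hq'⟩ hz h
    obtain ⟨a, b⟩ := c
    obtain ⟨a', b'⟩ := d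
    simp only [mem_corners, ne_eq, Prod.mk.injEq] at *
    rcases h with ⟨rfl, rfl⟩ | ⟨rfl, rfl⟩
    · have hv := CharTwo.add_eq_zero.1 ((hP.vertical x y).trans hz)
      have : (a = x ∧ a' = x - 1 ∨ a = x - 1 ∧ a' = x) ∧ b = y ∧ b' = y := by omega
      rcases this with ⟨⟨rfl, rfl⟩ | ⟨rfl, rfl⟩, rfl, rfl⟩
      · exact hv
      · exact hv.symm
    · have hv := CharTwo.add_eq_zero.1 ((hP.horizontal x y).trans hz)
      have : (b = y ∧ b' = y - 1 ∨ b = y - 1 ∧ b' = y) ∧ a = x ∧ a' = x := by omega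
      rcases this with ⟨⟨rfl, rfl⟩ | ⟨rfl, rfl⟩, rfl, rfl⟩
      · exact hv
      · exact hv.symm
  rcases hadj with ⟨h, h' | h'⟩ | ⟨h, h' | h'⟩
  · exact key p q hp hq hz (Or.inl ⟨h, h'⟩)
  · exact key q p hq hp (hsymm p q ▸ hz) (Or.inl ⟨h.symm, h'⟩)
  · exact key p q hp hq hz (Or.inr ⟨h, h'⟩)
  · exact key q p hq hp (hsymm p q ▸ hz) (Or.inr ⟨h.symm, h'⟩)

/-- Every mod 2 cycle of a polyomino graph bounds a set of squares. -/
theorem IsPolyomino.exists_isPrimitive {G : grid.Subgraph} (hG : IsPolyomino G)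
    {z : ℤ × ℤ → ℤ × ℤ → ZMod 2} (hz : IsCycle z) (hsymm : ∀ p q, z p q = z q p)
    (hsupp : ∀ p q, z p q ≠ 0 → G.Adj p q) :
    ∃ P : ℤ × ℤ → ZMod 2, IsPrimitive P z ∧ {c | P c ≠ 0}.Finite ∧
      ∀ c, P c ≠ 0 → c ∈ squares G := by
  obtain ⟨P, hP, hfin⟩ := hz.exists_isPrimitive hsymm hG.finite
    fun p q h => G.edge_vert (hsupp p q h)
  refine ⟨P, hP, hfin, fun c hc => ?_⟩
  have hconst : ∀ d, (cellGraph G).Reachable c d → P d = P c := by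
    rintro d ⟨w⟩
    induction w with
    | nil => rfl
    | cons h w ih =>
      have h' := hP.eq_of_cellGraph_adj hsymm hsupp h
      rw [ih (h' ▸ hc), h']
  -- `P` is nonzero on the whole face of `c` and has finite support, so this face is bounded.
  obtain ⟨d, hd, hF⟩ := hG.interior_face ((cellGraph G).connectedComponentMk c) <| by
    refine hfin.subset fun d hd => ?_
    have hr : (cellGraph G).Reachable c d :=
      (SimpleGraph.ConnectedComponent.exact hd).symm
    simpa [hconst d hr] using hc
  have : c ∈ ((cellGraph G).connectedComponentMk c).supp := rfl
  rw [hF] at this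
  exact (Set.mem_singleton_iff.1 this) ▸ hd

end Polyomino

/-! ### Symmetric differences of perfect matchings -/

namespace Polyomino

open Classical in
/-- The indicator function of the relation `R`, with values mod 2. -/
noncomputable def indicator (R : ℤ × ℤ → ℤ × ℤ → Prop) (p q : ℤ × ℤ) : ZMod 2 :=
  if R p q then 1 else 0

theorem indicator_congr {R R' : ℤ × ℤ → ℤ × ℤ → Prop} {p q p' q' : ℤ × ℤ}
    (h : R p q ↔ R' p' q') : indicator R p q = indicator R' p' q' := by
  classical
  unfold indicator
  exact if_congr h rfl rfl

/-- The relation `R` joins every vertex of `G` to exactly one of its neighbours. -/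
structure IsPairing (G : grid.Subgraph) (R : ℤ × ℤ → ℤ × ℤ → Prop) : Prop where
  symm : ∀ p q, R p q → R q p
  adj : ∀ p q, R p q → G.Adj p q
  existsUnique : ∀ p ∈ G.verts, ∃! q, R p q

variable {G : grid.Subgraph} {R R' : ℤ × ℤ → ℤ × ℤ → Prop}

theorem IsPairing.eq (hR : IsPairing G R) {p q q' : ℤ × ℤ} (h : R p q) (h' : R p q') : q = q' :=
  (hR.existsUnique p (G.edge_vert (hR.adj _ _ h))).unique h h'

-- The right side does not depend on `R`, so the contributions of two matchings cancel mod 2 and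
-- their symmetric difference is a cycle.
open Classical in
theorem IsPairing.sum_indicator (hR : IsPairing G R) (x y : ℤ) :
    indicator R (x, y) (x + 1, y) + indicator R (x, y) (x - 1, y) + indicator R (x, y) (x, y + 1)
      + indicator R (x, y) (x, y - 1) = if (x, y) ∈ G.verts then 1 else 0 := by
  split_ifs with h
  · obtain ⟨⟨a, b⟩, hq, hu⟩ := hR.existsUnique _ h
    have hadj := G.adj_sub (hR.adj _ _ hq)
    have hR' : ∀ q, R (x, y) q ↔ q = (a, b) := fun q => ⟨fun h => hu q h, fun h => h ▸ hq⟩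
    simp only [indicator, hR', Prod.mk.injEq]
    rw [grid_adj] at hadj
    have : (a = x + 1 ∧ b = y) ∨ (a = x - 1 ∧ b = y) ∨ (a = x ∧ b = y + 1) ∨
      (a = x ∧ b = y - 1) := by simp only at hadj; omega
    have e1 : x + 1 ≠ x - 1 := by omega
    have e2 : y + 1 ≠ y - 1 := by omega
    rcases this with ⟨rfl, rfl⟩ | ⟨rfl, rfl⟩ | ⟨rfl, rfl⟩ | ⟨rfl, rfl⟩ <;>
      simp [e1, e2, e1.symm, e2.symm]
  · have hR' : ∀ q, ¬ R (x, y) q := fun q hq => h (G.edge_vert (hR.adj _ _ hq))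
    simp [indicator, hR']

/-- If two perfect matchings of a polyomino graph differ, then there is a square both of whose
sides at the corner in a prescribed direction belong to their symmetric difference. -/
theorem IsPolyomino.exists_corner (hG : IsPolyomino G) (hR : IsPairing G R)
    (hR' : IsPairing G R') (hne : ∃ p q, R' p q ∧ ¬ R p q) {α β : ℤ} (hα : α = 0 ∨ α = 1)
    (hβ : β = 0 ∨ β = 1) :
    ∃ c ∈ squares G, ∃ p ∈ corners c, ∃ q ∈ corners c,
      R (c.1 + α, c.2 + β) p ∧ R' (c.1 + α, c.2 + β) q ∧ ¬ R (c.1 + α, c.2 + β) q := by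
  let z : ℤ × ℤ → ℤ × ℤ → ZMod 2 := fun p q => indicator R p q + indicator R' p q
  have hsymm : ∀ p q, z p q = z q p := fun p q =>
    congrArg₂ (· + ·) (indicator_congr ⟨hR.symm p q, hR.symm q p⟩)
      (indicator_congr ⟨hR'.symm p q, hR'.symm q p⟩)
  have hzero : ∀ p q, (R p q ↔ R' p q) → z p q = 0 := fun p q h => by
    simp only [z, indicator_congr h, CharTwo.add_self_eq_zero]
  have hcyc : IsCycle z := fun x y => by
    have h := (hR.sum_indicator x y).trans (hR'.sum_indicator x y).symm
    have h := CharTwo.add_eq_zero.2 h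
    simp only [z]
    linear_combination h
  obtain ⟨P, hP, hfin, hsq⟩ := hG.exists_isPrimitive hcyc hsymm fun p q h => by
    by_contra hadj
    exact h (hzero p q ⟨fun h => (hadj (hR.adj _ _ h)).elim, fun h => (hadj (hR'.adj _ _ h)).elim⟩)
  have hnonempty : {c | P c ≠ 0}.Nonempty := by
    by_contra hempty
    have hP0 : ∀ c, P c = 0 := fun c => by
      by_contra h
      exact hempty ⟨c, h⟩
    have hv : ∀ x y, z (x, y) (x, y + 1) = 0 := fun x y => by
      rw [← hP.vertical, hP0, hP0, add_zero]
    have hh : ∀ x y, z (x, y) (x + 1, y) = 0 := fun x y => by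
      rw [← hP.horizontal, hP0, hP0, add_zero]
    obtain ⟨⟨x, y⟩, ⟨x', y'⟩, h', h⟩ := hne
    have h1 : z (x, y) (x', y') ≠ 0 := by simp [z, indicator, h', h]
    rcases G.adj_sub (hR'.adj _ _ h') with ⟨h2, h3 | h3⟩ | ⟨h2, h3 | h3⟩ <;>
      simp only at h2 h3 <;> subst h2 <;> subst h3
    · exact h1 (hv _ _)
    · exact h1 (hsymm _ _ ▸ hv _ _)
    · exact h1 (hh _ _)
    · exact h1 (hsymm _ _ ▸ hh _ _)
  -- The weight grows towards the corner in direction `(α, β)`. At a maximal cell, the cells across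
  -- the two sides at that corner therefore have `P = 0`, which puts both sides in the symmetric
  -- difference.
  obtain ⟨⟨x, y⟩, hc, hmax⟩ := hfin.exists_maximalFor
    (fun c : ℤ × ℤ => (2 * α - 1) * c.1 + (2 * β - 1) * c.2) _ hnonempty
  have hout : ∀ d : ℤ × ℤ, (2 * α - 1) * x + (2 * β - 1) * y <
      (2 * α - 1) * d.1 + (2 * β - 1) * d.2 → P d = 0 := fun d hd => by
    by_contra h
    exact absurd (hmax (j := d) h hd.le) (not_le.2 hd)
  have hz1 : z (x + α, y + β) (x + α, y + (1 - β)) ≠ 0 := by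
    have h0 : P (x + (2 * α - 1), y) = 0 :=
      hout _ (by rcases hα with rfl | rfl <;> simp only <;> linarith)
    rcases hα with rfl | rfl
    · have h := hP.vertical x y
      norm_num [← sub_eq_add_neg] at h0
      rw [h0, add_zero] at h
      rcases hβ with rfl | rfl
      · simpa [← h] using hc
      · simpa [hsymm (x, y + 1), ← h] using hc
    · have h := hP.vertical (x + 1) y
      norm_num at h0
      rw [h0, zero_add, add_sub_cancel_right] at h
      rcases hβ with rfl | rfl
      · simpa [← h] using hc
      · simpa [hsymm (x + 1, y + 1), ← h] using hc
  have hz2 : z (x + α, y + β) (x + (1 - α), y + β) ≠ 0 := by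
    have h0 : P (x, y + (2 * β - 1)) = 0 :=
      hout _ (by rcases hβ with rfl | rfl <;> simp only <;> linarith)
    rcases hβ with rfl | rfl
    · have h := hP.horizontal x y
      norm_num [← sub_eq_add_neg] at h0
      rw [h0, add_zero] at h
      rcases hα with rfl | rfl
      · simpa [← h] using hc
      · simpa [hsymm (x + 1, y), ← h] using hc
    · have h := hP.horizontal x (y + 1)
      norm_num at h0
      rw [h0, zero_add, add_sub_cancel_right] at h
      rcases hα with rfl | rfl
      · simpa [← h] using hc
      · simpa [hsymm (x + 1, y + 1), ← h] using hc
  have hc1 : (x + α, y + (1 - β)) ∈ corners (x, y) := by simp only [mem_corners]; omega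
  have hc2 : (x + (1 - α), y + β) ∈ corners (x, y) := by simp only [mem_corners]; omega
  have hne' : (x + α, y + (1 - β)) ≠ (x + (1 - α), y + β) := by
    simp only [ne_eq, Prod.mk.injEq]; omega
  refine ⟨(x, y), hsq _ hc, ?_⟩
  have e1 := mt (hzero _ _) hz1
  have e2 := mt (hzero _ _) hz2
  by_cases h1 : R (x + α, y + β) (x + α, y + (1 - β))
  · have h2 : ¬ R (x + α, y + β) (x + (1 - α), y + β) := fun h => hne' (hR.eq h1 h)
    exact ⟨_, hc1, _, hc2, h1, by tauto, h2⟩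
  · have h1' : R' (x + α, y + β) (x + α, y + (1 - β)) := by tauto
    have h2' : ¬ R' (x + α, y + β) (x + (1 - α), y + β) := fun h => hne' (hR'.eq h1' h)
    exact ⟨_, hc2, _, hc1, by tauto, h1', h1⟩

end Polyomino

/-! ### Anti-forcing sets and alternating squares -/

namespace Polyomino

open AntiForcing

variable {G : grid.Subgraph}

/-- The remaining corners of a cell, given one of its sides `v p`. -/
theorem exists_corners {c v p : ℤ × ℤ} (hv : v ∈ corners c) (hp : p ∈ corners c)
    (hvp : grid.Adj v p) :
    ∃ q ∈ corners c, ∃ o ∈ corners c, grid.Adj v q ∧ q ≠ p ∧ o ≠ v ∧ grid.Adj p o ∧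
      grid.Adj q o ∧ ∀ q' ∈ corners c, grid.Adj v q' → q' = p ∨ q' = q := by
  obtain ⟨a, b⟩ := c
  obtain ⟨x, y⟩ := v
  obtain ⟨x', y'⟩ := p
  simp only [mem_corners, grid_adj] at hv hp hvp
  by_cases h : x' = x
  · subst h
    refine ⟨(2 * a + 1 - x', y), ?_, (2 * a + 1 - x', y'), ?_, ?_, ?_, ?_, ?_, ?_, ?_⟩ <;>
      simp only [mem_corners, grid_adj, ne_eq, Prod.mk.injEq, Prod.forall, true_and] <;> omega
  · refine ⟨(x, 2 * b + 1 - y), ?_, (x', 2 * b + 1 - y), ?_, ?_, ?_, ?_, ?_, ?_, ?_⟩ <;>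
      simp only [mem_corners, grid_adj, ne_eq, Prod.mk.injEq, Prod.forall, true_and] <;> omega

theorem mem_verts {c v : ℤ × ℤ} (hc : c ∈ squares G) (hv : v ∈ corners c) : v ∈ G.verts := by
  obtain ⟨p, hp, h⟩ : ∃ p ∈ corners c, grid.Adj v p := by
    refine ⟨(v.1, 2 * c.2 + 1 - v.2), ?_, ?_⟩ <;>
      simp only [mem_corners, grid_adj, true_and] at hv ⊢ <;> omega
  exact G.edge_vert (hc v hv p hp h)

/-- The adjacency relation of a subgraph of `G.coe`, as a relation on the points of the plane. -/
def ambient {H : SimpleGraph G.verts} (M : H.Subgraph) (p q : ℤ × ℤ) : Prop :=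
  ∃ hp hq, M.Adj ⟨p, hp⟩ ⟨q, hq⟩

@[simp]
theorem ambient_coe {H : SimpleGraph G.verts} (M : H.Subgraph) (p q : G.verts) :
    ambient M p q ↔ M.Adj p q :=
  ⟨fun ⟨_, _, h⟩ => h, fun h => ⟨p.2, q.2, h⟩⟩

theorem isPairing_ambient {H : SimpleGraph G.verts} (hH : H ≤ G.coe) {M : H.Subgraph}
    (hM : M.IsPerfectMatching) : IsPairing G (ambient M) where
  symm _ _ := fun ⟨hp, hq, h⟩ => ⟨hq, hp, h.symm⟩
  adj _ _ := fun ⟨_, _, h⟩ => hH h.adj_sub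
  existsUnique p hp := by
    obtain ⟨q, hq, hu⟩ := SimpleGraph.Subgraph.isPerfectMatching_iff.1 hM ⟨p, hp⟩
    exact ⟨q, ⟨hp, q.2, hq⟩, fun q' ⟨_, hq', h⟩ => congrArg Subtype.val (hu ⟨q', hq'⟩ h)⟩

/-- Every square is alternating: the partner of each corner of a square is a corner of it. -/
def IsAlternating (G : grid.Subgraph) (R : ℤ × ℤ → ℤ × ℤ → Prop) : Prop :=
  ∀ c ∈ squares G, ∀ v ∈ corners c, ∃ p ∈ corners c, R v p

/-- Each square of `T` contributes its side at the corner in direction `(α, β)` that is not in `M`.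
By `exists_corner`, any other perfect matching uses one of these sides. -/
theorem IsPolyomino.exists_isAntiForcingSet (hG : IsPolyomino G) {M : G.coe.Subgraph}
    (hM : M.IsPerfectMatching) {α β : ℤ} (hα : α = 0 ∨ α = 1) (hβ : β = 0 ∨ β = 1)
    {T : Finset (ℤ × ℤ)}
    (hT : ∀ c, c ∈ T ↔ c ∈ squares G ∧ ∃ p ∈ corners c, ambient M (c.1 + α, c.2 + β) p) :
    ∃ S : Finset (Sym2 G.verts), IsAntiForcingSet M (S : Set (Sym2 G.verts)) ∧
      S.card ≤ T.card := by
  classical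
  have hR := isPairing_ambient le_rfl hM
  have key : ∀ c : T, ∃ e : Sym2 G.verts, e ∈ G.coe.edgeSet \ M.edgeSet ∧
      ∀ v q : G.verts, (v : ℤ × ℤ) = (c.1.1 + α, c.1.2 + β) → (q : ℤ × ℤ) ∈ corners c.1 →
        G.coe.Adj v q → ¬ M.Adj v q → s(v, q) = e := by
    rintro ⟨c, hc⟩
    obtain ⟨hc, p, hp, hvp⟩ := (hT c).1 hc
    have hv : (c.1 + α, c.2 + β) ∈ corners c := by simp only [mem_corners]; omega
    obtain ⟨q, hq, o, ho, hvq, hqp, -, -, -, hu⟩ :=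
      exists_corners hv hp (G.adj_sub (hR.adj _ _ hvp))
    refine ⟨s(⟨_, mem_verts hc hv⟩, ⟨q, mem_verts hc hq⟩), ⟨hc _ hv _ hq hvq, ?_⟩, ?_⟩
    · intro h
      exact hqp (hR.eq ⟨_, _, h⟩ hvp)
    · rintro ⟨_, hv'⟩ ⟨q', hq'⟩ rfl hq'c hadj hM'
      rcases hu q' hq'c (G.adj_sub hadj) with rfl | rfl
      · exact (hM' ((ambient_coe M ⟨_, hv'⟩ ⟨_, hq'⟩).1 hvp)).elim
      · rfl
  choose f hf hf' using key
  refine ⟨T.attach.image f, ⟨?_, fun M' hM' => ?_⟩, Finset.card_image_le.trans_eq T.card_attach⟩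
  · intro e he
    simp only [Finset.coe_image, Set.mem_image] at he
    obtain ⟨c, -, rfl⟩ := he
    exact hf c
  · have hR' := isPairing_ambient (G.coe.deleteEdges_le _) hM'
    have hsub : ∀ p q : G.verts, M'.Adj p q → M.Adj p q := by
      by_contra! hcon
      obtain ⟨p, q, h', h⟩ := hcon
      obtain ⟨c, hc, p, hp, q, hq, hRp, ⟨hv, hqv, hM'q⟩, hRq⟩ :=
        hG.exists_corner hR hR' ⟨p, q, (ambient_coe M' p q).2 h', (ambient_coe M p q).not.2 h⟩ hα hβ
      have hadj := SimpleGraph.deleteEdges_adj.1 hM'q.adj_sub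
      refine hadj.2 ?_
      have hcT : c ∈ T := (hT c).2 ⟨hc, p, hp, hRp⟩
      rw [hf' ⟨c, hcT⟩ ⟨_, hv⟩ ⟨q, hqv⟩ rfl hq hadj.1 fun h => hRq ⟨hv, hqv, h⟩]
      simp
    ext e
    induction e with | _ p q
    refine ⟨hsub p q, fun h => ?_⟩
    obtain ⟨q', hq', -⟩ := SimpleGraph.Subgraph.isPerfectMatching_iff.1 hM' p
    have : q = q' := (SimpleGraph.Subgraph.isPerfectMatching_iff.1 hM p).unique h (hsub p q' hq')
    exact this ▸ hq'

theorem antiForcingNumber_le_card {V : Type*} {H : SimpleGraph V} {M : H.Subgraph}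
    {S : Finset (Sym2 V)} (hS : IsAntiForcingSet M (S : Set (Sym2 V))) :
    antiForcingNumber M ≤ S.card :=
  Nat.sInf_le ⟨S, hS, rfl⟩

/-- In the equality case no square can be missing from `T`, whichever corner is prescribed. -/
theorem IsPolyomino.antiForcingNumber_le (hG : IsPolyomino G) {n : ℕ}
    (hn : (squares G).encard = n) {M : G.coe.Subgraph} (hM : M.IsPerfectMatching) :
    antiForcingNumber M ≤ n ∧ (antiForcingNumber M = n → IsAlternating G (ambient M)) := by
  classical
  have hfin : (squares G).Finite := Set.finite_of_encard_eq_coe hn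
  have hcard : hfin.toFinset.card = n := by
    rw [hfin.encard_eq_coe_toFinset_card] at hn
    exact_mod_cast hn
  have key : ∀ α β : ℤ, (α = 0 ∨ α = 1) → (β = 0 ∨ β = 1) → antiForcingNumber M ≤
      (hfin.toFinset.filter fun c => ∃ p ∈ corners c, ambient M (c.1 + α, c.2 + β) p).card := by
    intro α β hα hβ
    obtain ⟨S, hS, hle⟩ := hG.exists_isAntiForcingSet hM hα hβ
      (T := hfin.toFinset.filter fun c => ∃ p ∈ corners c, ambient M (c.1 + α, c.2 + β) p)
      (fun c => by simp)
    exact (antiForcingNumber_le_card hS).trans hle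
  refine ⟨((key 0 0 (Or.inl rfl) (Or.inl rfl)).trans (Finset.card_filter_le _ _)).trans_eq hcard,
    fun h c hc v hv => ?_⟩
  have hle := key (v.1 - c.1) (v.2 - c.2) (by simp only [mem_corners] at hv; omega)
    (by simp only [mem_corners] at hv; omega)
  rw [h, ← hcard] at hle
  have heq := Finset.eq_of_subset_of_card_le (Finset.filter_subset _ _) hle
  have := Finset.filter_eq_self.1 heq c (by simpa using hc)
  simpa using this

theorem IsAlternating.exists_mem {M : G.coe.Subgraph} (hM : M.IsPerfectMatching)
    (halt : IsAlternating G (ambient M)) {S : Set (Sym2 G.verts)} (hS : IsAntiForcingSet M S)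
    {c : ℤ × ℤ} (hc : c ∈ squares G) :
    ∃ p q : G.verts, s(p, q) ∈ S ∧ (p : ℤ × ℤ) ∈ corners c ∧ (q : ℤ × ℤ) ∈ corners c ∧
      grid.Adj p q ∧ ¬ M.Adj p q := by
  classical
  by_contra! hcon
  have hR := isPairing_ambient le_rfl hM
  have hMu := SimpleGraph.Subgraph.isPerfectMatching_iff.1 hM
  -- `M` rotated along `c`: the two sides of `c` in `M` are exchanged for the other two, which avoid
  -- `S` by `hcon`.
  let M' : (G.coe.deleteEdges S).Subgraph :=
    { verts := Set.univ
      Adj := fun p q => if (p : ℤ × ℤ) ∈ corners c ∧ (q : ℤ × ℤ) ∈ corners c then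
        grid.Adj p q ∧ ¬ M.Adj p q else M.Adj p q
      adj_sub := by
        intro p q h
        rw [SimpleGraph.deleteEdges_adj]
        split_ifs at h with hpq
        · exact ⟨hc _ hpq.1 _ hpq.2 h.1, fun hmem => h.2 (hcon p q hmem hpq.1 hpq.2 h.1)⟩
        · exact ⟨h.adj_sub, fun hmem => (hS.1 hmem).2 h⟩
      edge_vert := fun _ => Set.mem_univ _
      symm := ⟨fun p q h => by
        simpa only [and_comm (a := (q : ℤ × ℤ) ∈ corners c), grid.adj_comm q p, M.adj_comm q p]
          using h⟩ }
  have other : ∀ v : G.verts, (v : ℤ × ℤ) ∈ corners c → ∃ q : G.verts, M'.Adj v q ∧ ¬ M.Adj v q ∧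
      ∀ q', M'.Adj v q' → q' = q := by
    intro v hv
    obtain ⟨p, hp, hvp⟩ := halt c hc v hv
    obtain ⟨q, hq, o, ho, hvq, hqp, -, -, -, hu⟩ :=
      exists_corners hv hp (G.adj_sub (hR.adj _ _ hvp))
    have hnot : ¬ M.Adj v ⟨q, mem_verts hc hq⟩ := fun h =>
      hqp (hR.eq ((ambient_coe M v ⟨q, _⟩).2 h) hvp)
    refine ⟨⟨q, mem_verts hc hq⟩, ?_, hnot, fun q' hq' => ?_⟩
    · change if _ then _ else _
      rw [if_pos ⟨hv, hq⟩]
      exact ⟨hvq, hnot⟩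
    · change if _ then _ else _ at hq'
      split_ifs at hq' with hmem
      · rcases hu q' hmem.2 hq'.1 with h | h
        · exact (hq'.2 ((ambient_coe M v q').1 (h ▸ hvp))).elim
        · exact Subtype.ext h
      · exact (hmem ⟨hv, hR.eq ((ambient_coe M v q').2 hq') hvp ▸ hp⟩).elim
  have hM' : M'.IsPerfectMatching := by
    refine SimpleGraph.Subgraph.isPerfectMatching_iff.2 fun v => ?_
    by_cases hv : (v : ℤ × ℤ) ∈ corners c
    · obtain ⟨q, hq, -, hu⟩ := other v hv
      exact ⟨q, hq, hu⟩
    · obtain ⟨q, hq, hu⟩ := hMu v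
      have hiff : ∀ q, M'.Adj v q ↔ M.Adj v q := fun q => by
        change (if _ then _ else _) ↔ _
        rw [if_neg fun h => hv h.1]
      exact ⟨q, (hiff q).2 hq, fun q' h => hu q' ((hiff q').1 h)⟩
  have hcc : c ∈ corners c := ⟨Or.inl rfl, Or.inl rfl⟩
  obtain ⟨q, hq, hnot, -⟩ := other ⟨c, mem_verts hc hcc⟩ hcc
  have hmem : s(⟨c, mem_verts hc hcc⟩, q) ∈ M'.edgeSet := hq
  rw [hS.2 M' hM'] at hmem
  exact hnot hmem

theorem IsPolyomino.antiForcingNumber_eq (hG : IsPolyomino G) {n : ℕ}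
    (hn : (squares G).encard = n) {M : G.coe.Subgraph} (hM : M.IsPerfectMatching)
    (halt : IsAlternating G (ambient M)) : antiForcingNumber M = n := by
  classical
  have hfin : (squares G).Finite := Set.finite_of_encard_eq_coe hn
  have hcard : hfin.toFinset.card = n := by
    rw [hfin.encard_eq_coe_toFinset_card] at hn
    exact_mod_cast hn
  have hR := isPairing_ambient le_rfl hM
  refine le_antisymm (hG.antiForcingNumber_le hn hM).1 (le_csInf ?_ ?_)
  -- Nonemptiness matters, since `sInf ∅ = 0`.
  · obtain ⟨S, hS, -⟩ := hG.exists_isAntiForcingSet hM (α := 0) (β := 0) (Or.inl rfl) (Or.inl rfl)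
      (T := hfin.toFinset.filter fun c => ∃ p ∈ corners c, ambient M (c.1 + 0, c.2 + 0) p)
      (fun c => by simp)
    exact ⟨_, S, hS, rfl⟩
  · rintro _ ⟨S, hS, rfl⟩
    have key : ∀ c : ℤ × ℤ, ∃ p q : G.verts, c ∈ squares G → s(p, q) ∈ S ∧
        (p : ℤ × ℤ) ∈ corners c ∧ (q : ℤ × ℤ) ∈ corners c ∧ grid.Adj p q ∧ ¬ M.Adj p q := by
      intro c
      by_cases hc : c ∈ squares G
      · obtain ⟨p, q, h⟩ := halt.exists_mem hM hS hc
        exact ⟨p, q, fun _ => h⟩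
      · obtain ⟨v, hv⟩ := hG.connected.nonempty
        exact ⟨⟨v, hv⟩, ⟨v, hv⟩, fun h => (hc h).elim⟩
    choose f g hfg using key
    rw [← hcard]
    refine Finset.card_le_card_of_injOn (fun c => s(f c, g c))
      (fun c hc => (hfg c (by simpa using hc)).1) ?_
    -- If two squares share a non-matching edge, both also contain the partner of one of its ends.
    -- Three common corners force the squares to coincide.
    intro c hc d hd hcd
    have hc : c ∈ squares G := by simpa using hc
    have hd : d ∈ squares G := by simpa using hd
    obtain ⟨-, hpc, hqc, hadj, hnot⟩ := hfg c hc
    obtain ⟨-, hpd, hqd, -, -⟩ := hfg d hd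
    have hmem : (f c : ℤ × ℤ) ∈ corners d ∧ (g c : ℤ × ℤ) ∈ corners d := by
      rcases Sym2.eq_iff.1 hcd with ⟨h1, h2⟩ | ⟨h1, h2⟩ <;> rw [h1, h2] <;> constructor <;>
        assumption
    obtain ⟨r, hr, hfr⟩ := halt c hc _ hpc
    obtain ⟨r', hr', hfr'⟩ := halt d hd _ hmem.1
    obtain rfl := hR.eq hfr hfr'
    have hadj' := G.adj_sub (hR.adj _ _ hfr)
    have hne : (g c : ℤ × ℤ) ≠ r := by
      rintro rfl
      exact hnot ((ambient_coe M _ _).1 hfr)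
    generalize (f c : ℤ × ℤ) = p at *
    generalize (g c : ℤ × ℤ) = q at *
    obtain ⟨hp', hq'⟩ := hmem
    simp only [mem_corners, grid_adj, ne_eq, Prod.ext_iff] at *
    clear hfg hcd
    omega

end Polyomino

/-! ### Alternating squares give a straight chain -/

namespace AntiForcing

/-- If the neighbours of `v` are joined to each other outside `v`, then deleting `v` does not
disconnect the graph. -/
theorem preconnected_induce_compl_singleton {V : Type*} {H : SimpleGraph V} (hH : H.Preconnected)
    (v : V) (hv : ∀ a b (ha : H.Adj v a) (hb : H.Adj v b),
      (H.induce {v}ᶜ).Reachable ⟨a, ha.ne'⟩ ⟨b, hb.ne'⟩) : (H.induce {v}ᶜ).Preconnected := by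
  have key : ∀ {x y : V} (w : H.Walk x y) (hx : x ≠ v) (hy : y ≠ v),
      (H.induce {v}ᶜ).Reachable ⟨x, hx⟩ ⟨y, hy⟩ := by
    intro x y w hx hy
    -- The walk may pass through `v`; the second clause carries the induction across such visits.
    suffices h : (∀ hx : x ≠ v, (H.induce {v}ᶜ).Reachable ⟨x, hx⟩ ⟨y, hy⟩) ∧
        (x = v → ∀ a (ha : H.Adj v a), (H.induce {v}ᶜ).Reachable ⟨a, ha.ne'⟩ ⟨y, hy⟩) from h.1 hx
    clear hx
    induction w with
    | nil => exact ⟨fun _ => .refl _, fun h => (hy h).elim⟩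
    | @cons x x' y h w ih =>
      obtain ⟨ih1, ih2⟩ := ih hy
      refine ⟨fun hx => ?_, ?_⟩
      · by_cases hx' : x' = v
        · subst hx'
          exact ih2 rfl x h.symm
        · have hadj : (H.induce {v}ᶜ).Adj ⟨x, hx⟩ ⟨x', hx'⟩ := h
          exact hadj.reachable.trans (ih1 hx')
      · rintro rfl a ha
        exact (hv a x' ha h).trans (ih1 h.ne')
  rintro ⟨x, hx⟩ ⟨y, hy⟩
  obtain ⟨w⟩ := hH x y
  exact key w hx hy

end AntiForcing

namespace Polyomino

open AntiForcing

variable {G : grid.Subgraph}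

theorem encard_cells_le_two {v w : ℤ × ℤ} (h : grid.Adj v w) :
    {c | v ∈ corners c ∧ w ∈ corners c}.encard ≤ 2 := by
  have key : ∀ a b : ℤ × ℤ, {c | v ∈ corners c ∧ w ∈ corners c} ⊆ {a, b} →
      {c | v ∈ corners c ∧ w ∈ corners c}.encard ≤ 2 := fun a b hab =>
    (Set.encard_le_encard hab).trans <|
      (Set.encard_insert_le _ _).trans_eq (by rw [Set.encard_singleton]; rfl)
  rcases h with h | h
  · refine key (v.1, min v.2 w.2) (v.1 - 1, min v.2 w.2) fun c ⟨hv, hw⟩ => ?_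
    simp only [mem_corners, Set.mem_insert_iff, Set.mem_singleton_iff, Prod.ext_iff] at *
    omega
  · refine key (min v.1 w.1, v.2) (min v.1 w.1, v.2 - 1) fun c ⟨hv, hw⟩ => ?_
    simp only [mem_corners, Set.mem_insert_iff, Set.mem_singleton_iff, Prod.ext_iff] at *
    omega

/-- A side of a square can be replaced by a path that avoids a given neighbouring corner. -/
theorem reachable_of_mem_square {c : ℤ × ℤ} (hc : c ∈ squares G) {v a b : G.verts}
    (hv : (v : ℤ × ℤ) ∈ corners c) (ha : (a : ℤ × ℤ) ∈ corners c) (hb : (b : ℤ × ℤ) ∈ corners c)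
    (hva : G.coe.Adj v a) (hvb : G.coe.Adj v b) :
    (G.coe.induce {v}ᶜ).Reachable ⟨a, hva.ne'⟩ ⟨b, hvb.ne'⟩ := by
  obtain ⟨q, hq, o, ho, hvq, hqa, hov, hao, hqo, hu⟩ := exists_corners hv ha (G.adj_sub hva)
  rcases hu b hb (G.adj_sub hvb) with h | h
  · obtain rfl : b = a := Subtype.ext h
    exact .refl _
  · have hov' : (⟨o, mem_verts hc ho⟩ : G.verts) ≠ v := fun h => hov (congrArg Subtype.val h)
    have h1 : (G.coe.induce {v}ᶜ).Adj ⟨a, hva.ne'⟩ ⟨⟨o, mem_verts hc ho⟩, hov'⟩ :=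
      hc _ ha _ ho hao
    have h2 : (G.coe.induce {v}ᶜ).Adj ⟨b, hvb.ne'⟩ ⟨⟨o, mem_verts hc ho⟩, hov'⟩ :=
      hc _ hb _ ho (h ▸ hqo)
    exact h1.reachable.trans h2.symm.reachable

/-- The partner `w` of `v` lies in every square at `v`. So these squares share the edge `v w`, and
after deleting `v` each neighbour of `v` still reaches `w` within a square. -/
theorem IsPolyomino.isStraightChain (hG : IsPolyomino G) {M : G.coe.Subgraph}
    (hM : M.IsPerfectMatching) (halt : IsAlternating G (ambient M)) : IsStraightChain G := by
  have hR := isPairing_ambient le_rfl hM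
  have hconn : G.coe.Connected := hG.connected.coe
  have partner : ∀ v : G.verts, ∃ w : G.verts, G.coe.Adj v w ∧
      ∀ c ∈ squares G, (v : ℤ × ℤ) ∈ corners c → (w : ℤ × ℤ) ∈ corners c := by
    intro v
    obtain ⟨w, hw, -⟩ := SimpleGraph.Subgraph.isPerfectMatching_iff.1 hM v
    refine ⟨w, hw.adj_sub, fun c hc hv => ?_⟩
    obtain ⟨p, hp, hvp⟩ := halt c hc v hv
    exact hR.eq hvp ((ambient_coe M v w).2 hw) ▸ hp
  refine ⟨hG, ⟨?_, hconn, fun v => ?_⟩, fun v hv => ?_⟩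
  · obtain ⟨v⟩ := hconn.nonempty
    obtain ⟨w, hw, -⟩ := partner v
    obtain ⟨c, hc, hvc, hwc⟩ := hG.edge_mem_square _ _ hw
    obtain ⟨q, hq, o, ho, hvq, hqp, -⟩ := exists_corners hvc hwc (G.adj_sub hw)
    have : ({v, w, ⟨q, mem_verts hc hq⟩} : Set G.verts).encard = 3 := by
      refine Set.encard_eq_three.2 ⟨_, _, _, hw.ne, fun h => ?_, fun h => ?_, rfl⟩
      · exact hvq.ne (congrArg Subtype.val h)
      · exact hqp (congrArg Subtype.val h).symm
    rw [← this, ← Set.encard_univ]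
    exact Set.encard_le_encard (Set.subset_univ _)
  · obtain ⟨w, hw, hwc⟩ := partner v
    have : Nonempty ({v}ᶜ : Set G.verts) := ⟨⟨w, hw.ne'⟩⟩
    refine ⟨preconnected_induce_compl_singleton hconn.preconnected v fun a b ha hb => ?_⟩
    have key : ∀ a (ha : G.coe.Adj v a),
        (G.coe.induce {v}ᶜ).Reachable ⟨a, ha.ne'⟩ ⟨w, hw.ne'⟩ := fun a ha => by
      obtain ⟨c, hc, hvc, hac⟩ := hG.edge_mem_square _ _ ha
      exact reachable_of_mem_square hc hvc hac (hwc c hc hvc) ha hw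
    exact (key a ha).trans (key b hb).symm
  · obtain ⟨w, hw, hwc⟩ := partner ⟨v, hv⟩
    have hsub : {c ∈ squares G | v ∈ corners c} ⊆ {c | v ∈ corners c ∧ (w : ℤ × ℤ) ∈ corners c} :=
      fun c hc => ⟨hc.2, hwc c hc.1 hc.2⟩
    exact (Set.encard_le_encard hsub).trans (encard_cells_le_two (G.adj_sub hw))

end Polyomino

/-! ### Straight chains have a matching with all squares alternating -/

namespace Polyomino

open AntiForcing

variable {G : grid.Subgraph}

/-- The number of times a walk traverses the edge `p q`, mod 2. -/
noncomputable def traversals {H : SimpleGraph (ℤ × ℤ)} {a b : ℤ × ℤ} (w : H.Walk a b)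
    (p q : ℤ × ℤ) : ZMod 2 :=
  w.edges.count s(p, q)

theorem sum_ite_edge_eq {a b : ℤ × ℤ} (h : grid.Adj a b) (x y : ℤ) :
    ((if s(a, b) = s((x, y), (x + 1, y)) then 1 else 0) +
      (if s(a, b) = s((x, y), (x - 1, y)) then 1 else 0) +
      (if s(a, b) = s((x, y), (x, y + 1)) then 1 else 0) +
      (if s(a, b) = s((x, y), (x, y - 1)) then 1 else 0) : ZMod 2) =
    (if a = (x, y) then 1 else 0) + (if b = (x, y) then 1 else 0) := by
  have nbr : ∀ q, grid.Adj (x, y) q →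
      q = (x + 1, y) ∨ q = (x - 1, y) ∨ q = (x, y + 1) ∨ q = (x, y - 1) := by
    rintro ⟨s, t⟩ h
    simp only [grid_adj, Prod.mk.injEq] at h ⊢
    omega
  have e1 : x + 1 ≠ x - 1 := by omega
  have e2 : y + 1 ≠ y - 1 := by omega
  by_cases ha : a = (x, y)
  · subst ha
    rcases nbr b h with rfl | rfl | rfl | rfl <;> simp [e1, e2, e1.symm, e2.symm]
  by_cases hb : b = (x, y)
  · subst hb
    rcases nbr a h.symm with rfl | rfl | rfl | rfl <;> simp [e1, e2, e1.symm, e2.symm]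
  simp [ha, hb]

/-- Each step contributes at its two ends, so inner visits cancel mod 2 and a closed walk gives a
cycle. -/
theorem sum_traversals {H : SimpleGraph (ℤ × ℤ)} (hH : H ≤ grid) {a b : ℤ × ℤ} (w : H.Walk a b)
    (x y : ℤ) :
    traversals w (x, y) (x + 1, y) + traversals w (x, y) (x - 1, y) + traversals w (x, y) (x, y + 1)
      + traversals w (x, y) (x, y - 1) =
    (if a = (x, y) then 1 else 0) + (if b = (x, y) then 1 else 0) := by
  induction w with
  | nil => simp [traversals, CharTwo.add_self_eq_zero]
  | @cons a a' b h w ih =>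
    have h1 := sum_ite_edge_eq (hH h) x y
    have two : (2 : ZMod 2) = 0 := by decide
    simp only [traversals, SimpleGraph.Walk.edges_cons, List.count_cons, Nat.cast_add,
      Nat.cast_ite, Nat.cast_one, Nat.cast_zero, beq_iff_eq] at ih ⊢
    linear_combination h1 + ih + (if a' = (x, y) then 1 else 0) * two

/-- In a 2-connected polyomino graph, a vertex with both horizontal neighbours has two squares
above or two squares below it. -/
theorem IsPolyomino.squares_of_adj_adj (hG : IsPolyomino G) (h2 : IsTwoConnected G.coe) {x y : ℤ}
    (hl : G.Adj (x, y) (x - 1, y)) (hr : G.Adj (x, y) (x + 1, y)) :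
    ((x, y) ∈ squares G ∧ (x - 1, y) ∈ squares G) ∨
      ((x, y - 1) ∈ squares G ∧ (x - 1, y - 1) ∈ squares G) := by
  let v : G.verts := ⟨(x, y), G.edge_vert hl⟩
  let l : ({v}ᶜ : Set G.verts) := ⟨⟨(x - 1, y), G.edge_vert hl.symm⟩, by simp [v]⟩
  let r : ({v}ᶜ : Set G.verts) := ⟨⟨(x + 1, y), G.edge_vert hr.symm⟩, by simp [v]⟩
  let f : G.coe.induce {v}ᶜ →g G.spanningCoe := ⟨fun p => p.1.1, fun h => h⟩
  obtain ⟨w⟩ := (h2.2.2 v).preconnected l r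
  let w' : G.spanningCoe.Walk (x - 1, y) (x + 1, y) := w.map f
  have hw' : (x, y) ∉ w'.support := by
    intro h
    rw [SimpleGraph.Walk.support_map, List.mem_map] at h
    obtain ⟨p, -, hp⟩ := h
    exact p.2 (Subtype.ext hp)
  have hl' : G.spanningCoe.Adj (x, y) (x - 1, y) := hl
  have hr' : G.spanningCoe.Adj (x + 1, y) (x, y) := hr.symm
  -- A walk from the left to the right neighbour avoiding `v`, closed up through `v`. At `v` it uses
  -- only the two horizontal edges, so its primitive agrees on the two cells above, agrees on the
  -- two below, and differs between above and below.
  let W : G.spanningCoe.Walk (x, y) (x, y) := .cons hl' (w'.concat hr')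
  have hsymm : ∀ p q, traversals W p q = traversals W q p := fun p q => by
    simp only [traversals, Sym2.eq_swap]
  obtain ⟨P, hP, -, hsq⟩ := hG.exists_isPrimitive (z := traversals W)
    (fun x y => by
      rw [sum_traversals (fun _ _ h => G.adj_sub h) W x y, CharTwo.add_self_eq_zero]) hsymm
    (fun p q h => by
      by_contra hadj
      refine h ?_
      have : s(p, q) ∉ W.edges := fun hmem => hadj (W.edges_subset_edgeSet hmem)
      simp [traversals, List.count_eq_zero_of_not_mem this])
  have hcount : ∀ q, traversals W (x, y) q =
      (if q = (x - 1, y) then 1 else 0) + (if q = (x + 1, y) then 1 else 0) := by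
    intro q
    have : s((x, y), q) ∉ w'.edges := fun h =>
      hw' (SimpleGraph.Walk.fst_mem_support_of_mem_edges _ h)
    have h0 := List.count_eq_zero_of_not_mem this
    have e1 : s((x, y), (x - 1, y)) = s((x, y), q) ↔ q = (x - 1, y) := by
      simp only [Sym2.congr_right, eq_comm]
    have e2 : s((x + 1, y), (x, y)) = s((x, y), q) ↔ q = (x + 1, y) := by
      rw [Sym2.eq_swap]
      simp only [Sym2.congr_right, eq_comm]
    simp only [traversals, W, SimpleGraph.Walk.edges_cons, SimpleGraph.Walk.edges_concat,
      List.concat_eq_append, List.count_cons, List.count_append, h0, List.count_nil, beq_iff_eq,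
      e1, e2]
    push_cast
    ring
  have h1 := hP.vertical x y
  have h3 := hP.horizontal x y
  have h4 := hP.horizontal (x - 1) y
  rw [sub_add_cancel, hsymm] at h4
  rw [hcount] at h1 h3 h4
  have e1 : x + 1 ≠ x - 1 := by omega
  simp [e1] at h1 h3
  simp [e1.symm] at h4
  by_cases h0 : P (x, y) = 0
  · right
    rw [h0, zero_add] at h1 h3
    rw [h1, zero_add] at h4
    exact ⟨hsq _ (by simp [h3]), hsq _ (by simp [h4])⟩
  · left
    refine ⟨hsq _ h0, hsq _ fun h => h0 ?_⟩
    rwa [h, add_zero] at h1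

theorem IsStraightChain.eq_of_mem (hG : IsStraightChain G) {c d e v : ℤ × ℤ} (hc : c ∈ squares G)
    (hd : d ∈ squares G) (he : e ∈ squares G) (hvc : v ∈ corners c) (hvd : v ∈ corners d)
    (hve : v ∈ corners e) : c = d ∨ c = e ∨ d = e := by
  by_contra! h
  have h3 : ({c, d, e} : Set (ℤ × ℤ)).encard = 3 :=
    Set.encard_eq_three.2 ⟨c, d, e, h.1, h.2.1, h.2.2, rfl⟩
  have hle := hG.2.2 v (mem_verts hc hvc)
  have : ({c, d, e} : Set (ℤ × ℤ)) ⊆ {c ∈ squares G | v ∈ corners c} := by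
    rintro _ (rfl | rfl | rfl) <;> exact ⟨‹_›, ‹_›⟩
  have := (Set.encard_le_encard this).trans hle
  rw [h3] at this
  exact absurd this (by decide)

/-- Two squares of a straight chain with a common vertex have a common side. -/
theorem IsStraightChain.adj_of_mem (hG : IsStraightChain G) {c d v : ℤ × ℤ} (hc : c ∈ squares G)
    (hd : d ∈ squares G) (hvc : v ∈ corners c) (hvd : v ∈ corners d) (hne : c ≠ d) :
    grid.Adj c d := by
  by_contra hadj
  have hside : ∀ e ∈ squares G, ∀ q, v ∈ corners e → q ∈ corners e → grid.Adj v q → G.Adj v q :=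
    fun e he q hv hq h => he v hv q hq h
  obtain ⟨x, y⟩ := v
  have hthree := fun e he => hG.eq_of_mem (e := e) hc hd he hvc hvd
  -- Without a common side, `c` and `d` are diagonally opposite at `v`, so together they contain
  -- both horizontal neighbours. Two squares on one side of `v` then include a third square at `v`.
  have hmem : ∀ q : ℤ × ℤ, grid.Adj (x, y) q → q.2 = y → q ∈ corners c ∨ q ∈ corners d := by
    intro q hq hqy
    simp only [mem_corners, grid_adj, ne_eq, Prod.ext_iff] at *
    clear hthree hside
    omega
  have hnbr : ∀ q : ℤ × ℤ, grid.Adj (x, y) q → q.2 = y → G.Adj (x, y) q := by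
    intro q hq hqy
    rcases hmem q hq hqy with h | h
    · exact hside c hc q hvc h hq
    · exact hside d hd q hvd h hq
  clear hside hmem
  have hl := hnbr (x - 1, y) (by simp [grid_adj]) rfl
  have hr := hnbr (x + 1, y) (by simp [grid_adj]) rfl
  rcases hG.1.squares_of_adj_adj hG.2.1 hl hr with ⟨h1, h2⟩ | ⟨h1, h2⟩
  · have h1 := hthree _ h1 (by simp [mem_corners])
    have h2 := hthree _ h2 (by simp [mem_corners])
    simp only [mem_corners, grid_adj, ne_eq, Prod.ext_iff] at *
    clear hthree hnbr
    omega
  · have h1 := hthree _ h1 (by simp [mem_corners])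
    have h2 := hthree _ h2 (by simp [mem_corners])
    simp only [mem_corners, grid_adj, ne_eq, Prod.ext_iff] at *
    clear hthree hnbr
    omega

/-- At a turn of the chain three squares would share a corner. -/
theorem IsStraightChain.not_horizontal_and_vertical (hG : IsStraightChain G) {c d e : ℤ × ℤ}
    (hc : c ∈ squares G) (hd : d ∈ squares G) (he : e ∈ squares G)
    (hcd : c.2 = d.2 ∧ (d.1 = c.1 + 1 ∨ c.1 = d.1 + 1)) :
    ¬ (c.1 = e.1 ∧ (e.2 = c.2 + 1 ∨ c.2 = e.2 + 1)) := by
  intro hce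
  have := hG.eq_of_mem (v := (max c.1 d.1, max c.2 e.2)) hc hd he
    (by simp only [mem_corners]; omega) (by simp only [mem_corners]; omega)
    (by simp only [mem_corners]; omega)
  simp only [Prod.ext_iff] at this
  omega

/-- The squares of a straight chain are all in one row or all in one column. -/
theorem IsStraightChain.horizontal_or_vertical (hG : IsStraightChain G) :
    (∀ c ∈ squares G, ∀ d ∈ squares G, grid.Adj c d → c.2 = d.2) ∨
      (∀ c ∈ squares G, ∀ d ∈ squares G, grid.Adj c d → c.1 = d.1) := by
  by_contra! h
  obtain ⟨⟨c, hc, d, hd, hcd, hcd'⟩, e, he, f, hf, hef, hef'⟩ := h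
  have hcd : c.1 = d.1 ∧ (d.2 = c.2 + 1 ∨ c.2 = d.2 + 1) := by
    rw [grid_adj] at hcd; omega
  have hef : e.2 = f.2 ∧ (f.1 = e.1 + 1 ∨ e.1 = f.1 + 1) := by
    rw [grid_adj] at hef; omega
  -- `A` marks the corners of squares that have a horizontal neighbour. As the chain cannot turn,
  -- `A` spreads along edges to all of `G`, including a common corner of the vertical pair `c`, `d`.
  let A : ℤ × ℤ → Prop := fun v => ∃ s ∈ squares G, v ∈ corners s ∧
    ∃ t ∈ squares G, s.2 = t.2 ∧ (t.1 = s.1 + 1 ∨ s.1 = t.1 + 1)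
  have hstep : ∀ v w, G.Adj v w → A v → A w := by
    rintro v w hvw ⟨s, hs, hvs, t, ht, hst⟩
    obtain ⟨u, hu, hvu, hwu⟩ := hG.1.edge_mem_square v w hvw
    by_cases hsu : s = u
    · exact ⟨s, hs, hsu ▸ hwu, t, ht, hst⟩
    · rcases hG.adj_of_mem hs hu hvs hvu hsu with h | h
      · exact (hG.not_horizontal_and_vertical hs ht hu hst h).elim
      · exact ⟨u, hu, hwu, s, hs, h.1.symm, h.2.symm⟩
  have hall : ∀ v w : G.verts, A v → A w := by
    intro v w
    obtain ⟨p⟩ := hG.1.connected.coe.preconnected v w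
    induction p with
    | nil => exact id
    | cons h _ ih => exact fun hA => ih (hstep _ _ h hA)
  have hee : e ∈ corners e := ⟨Or.inl rfl, Or.inl rfl⟩
  have hvc : (c.1, max c.2 d.2) ∈ corners c := by simp only [mem_corners, true_or, true_and]; omega
  have hvd : (c.1, max c.2 d.2) ∈ corners d := by simp only [mem_corners]; omega
  obtain ⟨s, hs, hvs, t, ht, hst⟩ := hall ⟨e, mem_verts he hee⟩ ⟨_, mem_verts hc hvc⟩
    ⟨e, he, hee, f, hf, hef⟩
  rcases hG.eq_of_mem hc hd hs hvc hvd hvs with h | rfl | rfl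
  · exact hcd' (congrArg Prod.snd h)
  · exact hG.not_horizontal_and_vertical hs ht hd hst hcd
  · exact hG.not_horizontal_and_vertical hs ht hc hst ⟨hcd.1.symm, hcd.2.symm⟩

theorem IsStraightChain.exists_square (hG : IsStraightChain G) {v : ℤ × ℤ} (hv : v ∈ G.verts) :
    ∃ c ∈ squares G, v ∈ corners c := by
  have hcard := hG.2.1.1
  have : Nontrivial G.verts := by
    rw [← ENat.one_lt_card_iff_nontrivial]
    exact lt_of_lt_of_le (by decide) hcard
  obtain ⟨w, hw⟩ := exists_ne (⟨v, hv⟩ : G.verts)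
  obtain ⟨p⟩ := hG.1.connected.coe.preconnected ⟨v, hv⟩ w
  cases p with
  | nil => exact (hw rfl).elim
  | cons h _ =>
    obtain ⟨c, hc, hvc, -⟩ := hG.1.edge_mem_square _ _ h
    exact ⟨c, hc, hvc⟩

/-- For a row, the vertical edges work: all squares at a vertex occupy the same row, so only one
vertical edge leaves it. Columns are symmetric. -/
theorem IsStraightChain.exists_isPairing (hG : IsStraightChain G) :
    ∃ R, IsPairing G R ∧ IsAlternating G R := by
  rcases hG.horizontal_or_vertical with h | h
  · have halt : IsAlternating G fun p q => G.Adj p q ∧ p.1 = q.1 := by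
      intro c hc v hv
      have hp : (v.1, 2 * c.2 + 1 - v.2) ∈ corners c := by
        simp only [mem_corners] at hv ⊢; omega
      refine ⟨_, hp, hc v hv _ hp ?_, rfl⟩
      simp only [mem_corners, grid_adj, true_and] at hv ⊢; omega
    refine ⟨_, ⟨fun p q h => ⟨h.1.symm, h.2.symm⟩, fun p q h => h.1, fun v hv => ?_⟩, halt⟩
    obtain ⟨c, hc, hvc⟩ := hG.exists_square hv
    obtain ⟨p, hp, hvp⟩ := halt c hc v hvc
    refine ⟨p, hvp, fun q hvq => ?_⟩
    obtain ⟨d, hd, hvd, hqd⟩ := hG.1.edge_mem_square v q hvq.1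
    have hcd : c.2 = d.2 := by
      by_cases hcd : c = d
      · rw [hcd]
      · exact h c hc d hd (hG.adj_of_mem hc hd hvc hvd hcd)
    have h1 := G.adj_sub hvp.1
    have h2 := G.adj_sub hvq.1
    simp only [mem_corners, grid_adj, Prod.ext_iff] at *
    omega
  · have halt : IsAlternating G fun p q => G.Adj p q ∧ p.2 = q.2 := by
      intro c hc v hv
      have hp : (2 * c.1 + 1 - v.1, v.2) ∈ corners c := by
        simp only [mem_corners] at hv ⊢; omega
      refine ⟨_, hp, hc v hv _ hp ?_, rfl⟩
      simp only [mem_corners, grid_adj, true_and] at hv ⊢; omega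
    refine ⟨_, ⟨fun p q h => ⟨h.1.symm, h.2.symm⟩, fun p q h => h.1, fun v hv => ?_⟩, halt⟩
    obtain ⟨c, hc, hvc⟩ := hG.exists_square hv
    obtain ⟨p, hp, hvp⟩ := halt c hc v hvc
    refine ⟨p, hvp, fun q hvq => ?_⟩
    obtain ⟨d, hd, hvd, hqd⟩ := hG.1.edge_mem_square v q hvq.1
    have hcd : c.1 = d.1 := by
      by_cases hcd : c = d
      · rw [hcd]
      · exact h c hc d hd (hG.adj_of_mem hc hd hvc hvd hcd)
    have h1 := G.adj_sub hvp.1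
    have h2 := G.adj_sub hvq.1
    simp only [mem_corners, grid_adj, Prod.ext_iff] at *
    omega

theorem IsStraightChain.exists_isPerfectMatching (hG : IsStraightChain G) :
    ∃ M : G.coe.Subgraph, M.IsPerfectMatching ∧ IsAlternating G (ambient M) := by
  obtain ⟨R, hR, halt⟩ := hG.exists_isPairing
  let M : G.coe.Subgraph :=
    { verts := Set.univ
      Adj := fun p q => R p q
      adj_sub := fun h => hR.adj _ _ h
      edge_vert := fun _ => Set.mem_univ _
      symm := ⟨fun p q h => hR.symm _ _ h⟩ }
  refine ⟨M, SimpleGraph.Subgraph.isPerfectMatching_iff.2 fun v => ?_, fun c hc v hv => ?_⟩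
  · obtain ⟨q, hq, hu⟩ := hR.existsUnique v v.2
    exact ⟨⟨q, G.edge_vert (hR.adj _ _ hq).symm⟩, hq, fun q' h => Subtype.ext (hu q' h)⟩
  · obtain ⟨p, hp, hvp⟩ := halt c hc v hv
    exact ⟨p, hp, mem_verts hc hv, mem_verts hc hp, hvp⟩

end Polyomino

theorem corollary3p8 (G : Polyomino.grid.Subgraph) (hG : Polyomino.IsPolyomino G) (n : ℕ)
    (hn : (Polyomino.squares G).encard = n) :
    AntiForcing.IsMaxAntiForcingNumber G.coe n ↔ Polyomino.IsStraightChain G := by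
  constructor
  · rintro ⟨⟨M, hM, hMn⟩, -⟩
    exact hG.isStraightChain hM ((hG.antiForcingNumber_le hn hM).2 hMn)
  · intro hchain
    obtain ⟨M, hM, halt⟩ := hchain.exists_isPerfectMatching
    refine ⟨⟨M, hM, hG.antiForcingNumber_eq hn hM halt⟩, ?_⟩
    rintro _ ⟨M', hM', rfl⟩
    exact (hG.antiForcingNumber_le hn hM').1
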